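/- Let $n\ge 1$ and let $S^n$ be the unit sphere of $\mathbb{R}^{n+1}$, with spherical distance $|PQ|=\arccos(P\cdot Q)$. A set $C\subseteq S^n$ is a spherical convex body if it is closed, has nonempty interior relative to $S^n$, and the cone $\{\lambda u:\lambda>0,\ u\in C\}$ is convex in $\mathbb{R}^{n+1}$; $\partial C$ denotes its boundary relative to $S^n$. Say that $C$ is of constant diameter $\tau$ if $\max\{|PQ|:P,Q\in C\}=\tau$ and for every $P\in\partial C$ there is $Q\in C$ with $|PQ|=\tau$. For $P\in S^n$ put $S_P=\{Q\in S^n:P\cdot Q=0\}$ and $S_P^+=\{Q\in S^n:P\cdot Q\ge 0\}$. The hemisphere $S_P^+$ is a supporting hemisphere of $C$ if $C\subseteq S_P^+$ and $\partial C\cap S_P\neq\emptyset$. If $Q\ne\pm P$, the set $S_P^+\cap S_Q^+$ is a lune, and its thickness is $\Delta(S_P^+\cap S_Q^+)=\pi-|PQ|$. The width of $C$ with respect to a supporting hemisphere $S_P^+$ is $$\mathrm{width}_{S_P^+}(C)=\min\{\Delta(S_P^+\cap S_Q^+): Q\in S^n,\ Q\neq\pm P,\ C\subseteq S_Q^+\},$$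 and $C$ is of constant width $\tau$ if $\mathrm{width}_{S_P^+}(C)=\tau$ for every supporting hemisphere $S_P^+$ of $C$. **Theorem.** Let $C$ be a spherical convex body in $S^n$ and let $0<\tau<\pi$. Then $C$ is of constant diameter $\tau$ if and only if $C$ is of constant width $\tau$. (No smoothness of $\partial C$ is assumed.) -/

import Mathlib

namespace SphericalConvexity

/-- The unit sphere `S^n` of `ℝ^(n+1)`, with its subspace topology; closures, interiors and
boundaries of subsets are taken relative to `S^n`. -/
abbrev UnitSphere (n : ℕ) : Type :=
  Metric.sphere (0 : EuclideanSpace ℝ (Fin (n + 1))) 1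

/-- The spherical (geodesic) distance `|PQ|`. -/
noncomputable def sphDist {n : ℕ} (P Q : UnitSphere n) : ℝ :=
  Real.arccos (inner ℝ (P : EuclideanSpace ℝ (Fin (n + 1))) (Q : EuclideanSpace ℝ (Fin (n + 1))))

/-- The cone `{λ u : λ > 0, u ∈ K}`, with apex excluded. -/
def openCone {n : ℕ} (K : Set (UnitSphere n)) : Set (EuclideanSpace ℝ (Fin (n + 1))) :=
  {x | ∃ c : ℝ, 0 < c ∧ ∃ u ∈ K, x = c • (u : EuclideanSpace ℝ (Fin (n + 1)))}

/-- `K` is spherically convex. Since the cone omits its apex, a spherically convex set contains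
no pair of antipodal points. -/
def IsSphericallyConvex {n : ℕ} (K : Set (UnitSphere n)) : Prop :=
  Convex ℝ (openCone K)

/-- A spherical convex body: closed, spherically convex, with nonempty interior in `S^n`. -/
structure IsSphericalConvexBody {n : ℕ} (K : Set (UnitSphere n)) : Prop where
  isClosed : IsClosed K
  convex : IsSphericallyConvex K
  interior_nonempty : (interior K).Nonempty

/-- `K` has diameter `d`: the maximum of the distances between points of `K` is `d`. -/
def HasDiameter {n : ℕ} (K : Set (UnitSphere n)) (d : ℝ) : Prop :=
  IsGreatest {r : ℝ | ∃ P ∈ K, ∃ Q ∈ K, r = sphDist P Q} d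

/-- `K` is of constant diameter `τ`. -/
def HasConstantDiameter {n : ℕ} (K : Set (UnitSphere n)) (τ : ℝ) : Prop :=
  HasDiameter K τ ∧ ∀ P ∈ frontier K, ∃ Q ∈ K, sphDist P Q = τ

/-- The hypersphere `S_P` centered at `P`. -/
def hypersphere {n : ℕ} (P : UnitSphere n) : Set (UnitSphere n) :=
  {Q | inner ℝ (P : EuclideanSpace ℝ (Fin (n + 1))) (Q : EuclideanSpace ℝ (Fin (n + 1))) = 0}

/-- The closed hemisphere `S⁺_P` centered at `P`. -/
def hemisphere {n : ℕ} (P : UnitSphere n) : Set (UnitSphere n) :=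
  {Q | 0 ≤ inner ℝ (P : EuclideanSpace ℝ (Fin (n + 1))) (Q : EuclideanSpace ℝ (Fin (n + 1)))}

/-- The hemisphere centered at `Q` supports `K` at `P`: it contains `K`, and `P` is a boundary
point of `K` lying on the hypersphere that bounds the hemisphere. -/
def SupportsAt {n : ℕ} (K : Set (UnitSphere n)) (Q P : UnitSphere n) : Prop :=
  K ⊆ hemisphere Q ∧ P ∈ frontier K ∩ hypersphere Q

/-- The hemisphere centered at `Q` is a supporting hemisphere of `K`. -/
def IsSupportingHemisphere {n : ℕ} (K : Set (UnitSphere n)) (Q : UnitSphere n) : Prop :=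
  ∃ P, SupportsAt K Q P

/-- The hemispheres centered at `P` and `Q` are different and not opposite, so that their
intersection is a lune. -/
def FormLune {n : ℕ} (P Q : UnitSphere n) : Prop :=
  P ≠ Q ∧ Q ≠ -P

/-- The thickness of the lune that is the intersection of the hemispheres centered at
`P` and `Q`. -/
noncomputable def luneThickness {n : ℕ} (P Q : UnitSphere n) : ℝ :=
  Real.pi - sphDist P Q

/-- The width of `K` with respect to the hemisphere centered at `P` is `w`: the minimum of
the thicknesses of the lunes `S⁺_P ∩ S⁺_Q` with `K ⊆ S⁺_Q` is (attained and equal to) `w`. -/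
def HasWidthAt {n : ℕ} (K : Set (UnitSphere n)) (P : UnitSphere n) (w : ℝ) : Prop :=
  IsLeast {t : ℝ | ∃ Q, FormLune P Q ∧ K ⊆ hemisphere Q ∧ t = luneThickness P Q} w

/-- `K` is of constant width `τ`: its width with respect to every supporting hemisphere
is `τ`. -/
def HasConstantWidth {n : ℕ} (K : Set (UnitSphere n)) (τ : ℝ) : Prop :=
  ∀ P, IsSupportingHemisphere K P → HasWidthAt K P τ

end SphericalConvexity

namespace SphericalConvexity

open scoped RealInnerProductSpace
open Filter Topology

/-! ### Polar duality for spherical convex bodies -/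

section Duality

variable {n : ℕ} {C : Set (UnitSphere n)}

/-! Polarity carries the equivalence. The polar `dual C` is again a convex body, `dual (dual C) =
C`, and the centers of supporting hemispheres of `C` are exactly the boundary points of `dual C`.
Since the thickness of a lune is `π` minus the distance of its centers, constant width `τ` of `C`
yields constant diameter `π - τ` of `dual C` (`HasConstantWidth.hasConstantDiameter_dual`). Once
constant diameter is known to imply constant width, the converse follows by applying that
implication to `dual C` and dualizing back.

The hard implication rests on `isDiametralNormal_of_inner_eq_zero`: if `C` has constant diameter `τ`
and `P` is any normal at a boundary point `p`, then `cos τ • p + sin τ • P` lies in `C`. The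
hypothesis gives this only for some normal at `p`, and without smoothness there may be many. Limits
of diametral normals at boundary points approaching `p` from prescribed directions provide enough of
them to control `P` (`exists_normal_inner_le`). For `τ ≤ π / 2` one concludes by completeness: a
point within `τ` of all of `C` belongs to `C`. For `τ > π / 2` the farthest point from `p` is
unique, hence so is the diametral normal, and `P` must equal it. -/

/-- The spherical polar of `C`: the centers of all hemispheres containing `C`. -/
def dual (C : Set (UnitSphere n)) : Set (UnitSphere n) := {Q | C ⊆ hemisphere Q}

theorem mem_dual {Q : UnitSphere n} :
    Q ∈ dual C ↔ ∀ x ∈ C, 0 ≤ ⟪(Q : EuclideanSpace ℝ (Fin (n + 1))), x⟫ := Iff.rfl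

theorem inner_self_coe (u : UnitSphere n) :
    ⟪(u : EuclideanSpace ℝ (Fin (n + 1))), u⟫ = 1 := by
  rw [real_inner_self_eq_norm_sq, norm_eq_of_mem_sphere]; norm_num

theorem coe_ne_zero (u : UnitSphere n) : (u : EuclideanSpace ℝ (Fin (n + 1))) ≠ 0 := by
  intro h
  have := inner_self_coe u
  simp [h] at this

theorem inner_coe_le_one (u v : UnitSphere n) :
    ⟪(u : EuclideanSpace ℝ (Fin (n + 1))), v⟫ ≤ 1 := by
  have := real_inner_le_norm (u : EuclideanSpace ℝ (Fin (n + 1))) v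
  simpa using this

theorem neg_one_le_inner_coe (u v : UnitSphere n) :
    -1 ≤ ⟪(u : EuclideanSpace ℝ (Fin (n + 1))), v⟫ := by
  have := neg_le_of_abs_le (abs_real_inner_le_norm (u : EuclideanSpace ℝ (Fin (n + 1))) v)
  simpa using this

theorem eq_of_one_le_inner {u v : UnitSphere n}
    (h : 1 ≤ ⟪(u : EuclideanSpace ℝ (Fin (n + 1))), v⟫) : u = v := by
  have h1 := le_antisymm (inner_coe_le_one u v) h
  exact Subtype.ext ((inner_eq_one_iff_of_norm_eq_one (by simp) (by simp)).1 h1)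

theorem eq_neg_of_inner_le_neg_one {u v : UnitSphere n}
    (h : ⟪(u : EuclideanSpace ℝ (Fin (n + 1))), v⟫ ≤ -1) : v = -u := by
  symm
  apply eq_of_one_le_inner
  rw [coe_neg_sphere, inner_neg_left]
  linarith

theorem exists_eq_smul_coe {y : EuclideanSpace ℝ (Fin (n + 1))} (hy : y ≠ 0) :
    ∃ u : UnitSphere n, y = ‖y‖ • (u : EuclideanSpace ℝ (Fin (n + 1))) := by
  have h : ‖y‖ ≠ 0 := norm_ne_zero_iff.2 hy
  refine ⟨⟨‖y‖⁻¹ • y, ?_⟩, ?_⟩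
  · simp [norm_smul, h]
  · simp [smul_smul, h]

theorem norm_smul_coe {c : ℝ} (hc : 0 < c) (u : UnitSphere n) :
    ‖c • (u : EuclideanSpace ℝ (Fin (n + 1)))‖ = c := by
  simp [norm_smul, abs_of_pos hc]

theorem smul_coe_mem_openCone {c : ℝ} (hc : 0 < c) {u : UnitSphere n} :
    c • (u : EuclideanSpace ℝ (Fin (n + 1))) ∈ openCone C ↔ u ∈ C := by
  constructor
  · rintro ⟨d, hd, v, hv, h⟩
    have hcd : c = d := by rw [← norm_smul_coe hc u, h, norm_smul_coe hd]
    subst hcd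
    have : u = v := Subtype.ext (smul_right_injective _ hc.ne' h)
    exact this ▸ hv
  · exact fun h => ⟨c, hc, u, h, rfl⟩

theorem coe_mem_openCone {u : UnitSphere n} :
    (u : EuclideanSpace ℝ (Fin (n + 1))) ∈ openCone C ↔ u ∈ C := by
  simpa using smul_coe_mem_openCone (C := C) (u := u) one_pos

theorem smul_mem_openCone {c : ℝ} (hc : 0 < c) {y : EuclideanSpace ℝ (Fin (n + 1))}
    (hy : y ∈ openCone C) : c • y ∈ openCone C := by
  obtain ⟨d, hd, v, hv, rfl⟩ := hy
  exact ⟨c * d, mul_pos hc hd, v, hv, smul_smul _ _ _⟩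

theorem zero_notMem_openCone : (0 : EuclideanSpace ℝ (Fin (n + 1))) ∉ openCone C := by
  rintro ⟨d, hd, v, -, h⟩
  exact smul_ne_zero hd.ne' (coe_ne_zero v) h.symm

theorem add_mem_openCone (hC : IsSphericallyConvex C) {x y : EuclideanSpace ℝ (Fin (n + 1))}
    (hx : x ∈ openCone C) (hy : y ∈ openCone C) : x + y ∈ openCone C := by
  have h := hC hx hy (by norm_num : (0 : ℝ) ≤ 1 / 2) (by norm_num : (0 : ℝ) ≤ 1 / 2) (by norm_num)
  have h2 := smul_mem_openCone (C := C) two_pos h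
  simpa [smul_smul, smul_add] using h2

theorem mem_openCone_dual {y : EuclideanSpace ℝ (Fin (n + 1))} (hy : y ≠ 0) :
    y ∈ openCone (dual C) ↔ ∀ x ∈ C, 0 ≤ ⟪y, (x : EuclideanSpace ℝ (Fin (n + 1)))⟫ := by
  obtain ⟨u, hu⟩ := exists_eq_smul_coe hy
  have hc : 0 < ‖y‖ := norm_pos_iff.2 hy
  rw [hu, smul_coe_mem_openCone hc, mem_dual]
  simp [inner_smul_left, mul_nonneg_iff_of_pos_left hc]

theorem isClosed_dual : IsClosed (dual C) := by
  have : dual C = ⋂ x ∈ C, {Q : UnitSphere n |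
      0 ≤ ⟪(Q : EuclideanSpace ℝ (Fin (n + 1))), (x : EuclideanSpace ℝ (Fin (n + 1)))⟫} := by
    ext Q; simp [mem_dual]
  rw [this]
  exact isClosed_biInter fun x _ => isClosed_le continuous_const (by fun_prop)

/-- Away from the apex radial projection is continuous, and it maps the cone into the compact set
`C`. The apex is added because the rays accumulate there. -/
theorem isClosed_insert_zero_openCone (hC : IsClosed C) :
    IsClosed (insert 0 (openCone C)) := by
  rw [← isOpen_compl_iff, isOpen_iff_mem_nhds]
  intro y hy
  have hy0 : y ≠ 0 := fun h => hy (by simp [h])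
  have hyC : y ∉ openCone C := fun h => hy (by simp [h])
  by_contra hcon
  have hfr : ∃ᶠ z in 𝓝 y, z ∈ insert 0 (openCone C) := by
    intro h
    exact hcon (by filter_upwards [h] with z hz using hz)
  have hfr2 : ∃ᶠ z in 𝓝 y, z ∈ openCone C := by
    refine (hfr.and_eventually (eventually_ne_nhds hy0)).mono ?_
    rintro z ⟨hz, hz0⟩
    exact hz.resolve_left hz0
  have hcl : IsClosed ((↑) '' C : Set (EuclideanSpace ℝ (Fin (n + 1)))) :=
    (hC.isCompact.image continuous_subtype_val).isClosed
  have hcont : Tendsto (fun z : EuclideanSpace ℝ (Fin (n + 1)) => ‖z‖⁻¹ • z) (𝓝 y)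
      (𝓝 (‖y‖⁻¹ • y)) := by
    have : ContinuousAt (fun z : EuclideanSpace ℝ (Fin (n + 1)) => ‖z‖⁻¹ • z) y :=
      (continuousAt_id.norm.inv₀ (norm_ne_zero_iff.2 hy0)).smul continuousAt_id
    exact this
  have hmem := hcl.mem_of_frequently_of_tendsto (f := fun z => ‖z‖⁻¹ • z) (b := 𝓝 y)
    (hfr2.mono ?_) hcont
  · obtain ⟨u, hu, hue⟩ := hmem
    refine hyC ⟨‖y‖, norm_pos_iff.2 hy0, u, hu, ?_⟩
    rw [hue, smul_smul, mul_inv_cancel₀ (norm_ne_zero_iff.2 hy0), one_smul]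
  · rintro z ⟨c, hc, u, hu, rfl⟩
    refine ⟨u, hu, ?_⟩
    simp only [norm_smul_coe hc, smul_smul, inv_mul_cancel₀ hc.ne', one_smul]

theorem convex_insert_zero_openCone (hC : IsSphericallyConvex C) :
    Convex ℝ (insert 0 (openCone C)) := by
  rw [convex_iff_forall_pos]
  rintro x hx y hy a b ha hb -
  rcases hx with rfl | hx <;> rcases hy with rfl | hy
  · simp
  · right; simpa using smul_mem_openCone hb hy
  · right; simpa using smul_mem_openCone ha hx
  · right; exact add_mem_openCone hC (smul_mem_openCone ha hx) (smul_mem_openCone hb hy)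

/-- The bipolar theorem. -/
theorem mem_openCone_of_forall_dual (hcl : IsClosed C) (hC : IsSphericallyConvex C)
    {y : EuclideanSpace ℝ (Fin (n + 1))} (hy0 : y ≠ 0)
    (hy : ∀ Q ∈ dual C, 0 ≤ ⟪(Q : EuclideanSpace ℝ (Fin (n + 1))), y⟫) : y ∈ openCone C := by
  by_contra hyC
  have hyK : y ∉ insert 0 (openCone C) := by simp [hy0, hyC]
  obtain ⟨f, s, hf, hs⟩ := geometric_hahn_banach_closed_point
    (convex_insert_zero_openCone hC) (isClosed_insert_zero_openCone hcl) hyK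
  have hs0 : 0 < s := by simpa using hf 0 (by simp)
  -- A functional bounded above on a cone is nonpositive there: otherwise rescaling `x` makes it
  -- take the value `s` itself.
  have hneg : ∀ x ∈ openCone C, f x ≤ 0 := by
    intro x hx
    by_contra! hpos
    have := hf ((s / f x) • x) (Or.inr (smul_mem_openCone (div_pos hs0 hpos) hx))
    rw [map_smul, smul_eq_mul, div_mul_cancel₀ _ hpos.ne'] at this
    exact lt_irrefl _ this
  set g := (InnerProductSpace.toDual ℝ (EuclideanSpace ℝ (Fin (n + 1)))).symm f with hg
  have hgf : ∀ x, ⟪g, x⟫ = f x := fun x => by simp [hg]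
  have hg0 : -g ≠ 0 := by
    intro h
    have : f y = 0 := by rw [← hgf, neg_eq_zero.1 h, inner_zero_left]
    linarith
  obtain ⟨d, hd, Q, hQ, hQe⟩ := (mem_openCone_dual (C := C) hg0).2 (fun x hx => by
    rw [inner_neg_left, hgf]
    linarith [hneg x (coe_mem_openCone.2 hx)])
  have h1 : ⟪-g, y⟫ = d * ⟪(Q : EuclideanSpace ℝ (Fin (n + 1))), y⟫ := by
    rw [hQe, inner_smul_left]; rfl
  rw [inner_neg_left, hgf] at h1
  have := mul_nonneg hd.le (hy Q hQ)
  linarith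

theorem dual_dual (hcl : IsClosed C) (hC : IsSphericallyConvex C) : dual (dual C) = C := by
  ext z
  constructor
  · intro hz
    refine coe_mem_openCone.1 (mem_openCone_of_forall_dual hcl hC (coe_ne_zero z) fun Q hQ => ?_)
    rw [real_inner_comm]
    exact hz hQ
  · intro hz Q hQ
    have := hQ hz
    unfold hemisphere at *
    simpa [real_inner_comm] using this

/-- An interior point of `C` is not orthogonal to any point of the polar of `C`. -/
theorem inner_pos_of_mem_interior {x : UnitSphere n} (hx : x ∈ interior C) {Q : UnitSphere n}
    (hQ : Q ∈ dual C) : 0 < ⟪(Q : EuclideanSpace ℝ (Fin (n + 1))), x⟫ := by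
  refine lt_of_le_of_ne (hQ (interior_subset hx)) fun h0 => ?_
  have hne : ∀ t : ℝ, (x : EuclideanSpace ℝ (Fin (n + 1))) - t • (Q : EuclideanSpace ℝ (Fin (n + 1))) ≠ 0 := by
    intro t h
    have h2 : ⟪(x : EuclideanSpace ℝ (Fin (n + 1))) - t • (Q : EuclideanSpace ℝ (Fin (n + 1))), x⟫ = 0 := by
      rw [h, inner_zero_left]
    rw [inner_sub_left, inner_smul_left, ← h0, inner_self_coe] at h2
    simp at h2
  -- If `x ⟂ Q`, moving from `x` in the direction `-Q` leaves the hemisphere of `Q` at once, yet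
  -- stays in `C` for small `t`.
  let γ : ℝ → UnitSphere n := fun t =>
    ⟨‖(x : EuclideanSpace ℝ (Fin (n + 1))) - t • (Q : EuclideanSpace ℝ (Fin (n + 1)))‖⁻¹ •
      ((x : EuclideanSpace ℝ (Fin (n + 1))) - t • (Q : EuclideanSpace ℝ (Fin (n + 1)))), by
        simp [norm_smul, norm_ne_zero_iff.2 (hne t)]⟩
  have hγ : Continuous γ := by
    have hlin : Continuous fun t : ℝ => (x : EuclideanSpace ℝ (Fin (n + 1))) -
        t • (Q : EuclideanSpace ℝ (Fin (n + 1))) := by fun_prop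
    exact ((hlin.norm.inv₀ fun t => norm_ne_zero_iff.2 (hne t)).smul hlin).subtype_mk _
  have hγ0 : γ 0 = x := Subtype.ext (by simp [γ])
  have hev : ∀ᶠ t in 𝓝 (0 : ℝ), γ t ∈ C := by
    have : C ∈ 𝓝 (γ 0) := by rw [hγ0]; exact mem_interior_iff_mem_nhds.1 hx
    exact hγ.continuousAt this
  obtain ⟨t, ht, ht0⟩ := ((hev.filter_mono nhdsWithin_le_nhds).and
    (self_mem_nhdsWithin : Set.Ioi (0 : ℝ) ∈ 𝓝[>] 0)).exists
  have h1 := hQ ht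
  have ht0' : (0 : ℝ) < t := ht0
  have h2 : ⟪(Q : EuclideanSpace ℝ (Fin (n + 1))), γ t⟫ =
      ‖(x : EuclideanSpace ℝ (Fin (n + 1))) - t • (Q : EuclideanSpace ℝ (Fin (n + 1)))‖⁻¹ * (-t) := by
    simp only [γ, inner_smul_right, inner_sub_right, inner_self_coe, ← h0]
    ring
  have h3 : 0 < ‖(x : EuclideanSpace ℝ (Fin (n + 1))) - t • (Q : EuclideanSpace ℝ (Fin (n + 1)))‖⁻¹ :=
    inv_pos.2 (norm_pos_iff.2 (hne t))
  have h4 : (0 : ℝ) ≤ ⟪(Q : EuclideanSpace ℝ (Fin (n + 1))), γ t⟫ := h1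
  rw [h2] at h4
  nlinarith

/-- By compactness `⟪P, x⟫` has a positive minimum on `C`; this minimum serves as the radius of a
ball around `P` inside the polar. -/
theorem mem_interior_dual (hC : IsClosed C) {P : UnitSphere n}
    (hP : ∀ x ∈ C, 0 < ⟪(P : EuclideanSpace ℝ (Fin (n + 1))), x⟫) : P ∈ interior (dual C) := by
  rcases C.eq_empty_or_nonempty with rfl | hne
  · have : dual (∅ : Set (UnitSphere n)) = Set.univ := by ext; simp [dual]
    simp [this]
  obtain ⟨x₀, hx₀, hmin⟩ := hC.isCompact.exists_isMinOn hne
    (f := fun x => ⟪(P : EuclideanSpace ℝ (Fin (n + 1))), x⟫)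
    (Continuous.continuousOn (by fun_prop))
  rw [mem_interior_iff_mem_nhds, Metric.mem_nhds_iff]
  refine ⟨_, hP x₀ hx₀, fun Q hQ x hx => ?_⟩
  have h1 : ⟪(P : EuclideanSpace ℝ (Fin (n + 1))), x₀⟫ ≤ ⟪(P : EuclideanSpace ℝ (Fin (n + 1))), x⟫ :=
    hmin hx
  have h2 : ‖(P : EuclideanSpace ℝ (Fin (n + 1))) - Q‖ < ⟪(P : EuclideanSpace ℝ (Fin (n + 1))), x₀⟫ := by
    rw [← dist_eq_norm, dist_comm]
    exact hQ
  have h3 := real_inner_le_norm ((P : EuclideanSpace ℝ (Fin (n + 1))) - Q) x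
  rw [inner_sub_left, norm_eq_of_mem_sphere, mul_one] at h3
  change (0 : ℝ) ≤ ⟪(Q : EuclideanSpace ℝ (Fin (n + 1))), x⟫
  linarith

theorem mem_frontier_iff (hC : IsSphericalConvexBody C) {p : UnitSphere n} :
    p ∈ frontier C ↔
      p ∈ C ∧ ∃ Q ∈ dual C, ⟪(Q : EuclideanSpace ℝ (Fin (n + 1))), p⟫ = 0 := by
  rw [hC.isClosed.frontier_eq]
  constructor
  · rintro ⟨hp, hpi⟩
    refine ⟨hp, ?_⟩
    by_contra! h
    apply hpi
    rw [← dual_dual hC.isClosed hC.convex]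
    refine mem_interior_dual isClosed_dual fun Q hQ => ?_
    rw [real_inner_comm]
    exact lt_of_le_of_ne (hQ hp) (h Q hQ).symm
  · rintro ⟨hp, Q, hQ, h⟩
    exact ⟨hp, fun hpi => (inner_pos_of_mem_interior hpi hQ).ne' h⟩

theorem isSupportingHemisphere_iff (hC : IsSphericalConvexBody C) {P : UnitSphere n} :
    IsSupportingHemisphere C P ↔
      P ∈ dual C ∧ ∃ p ∈ C, ⟪(P : EuclideanSpace ℝ (Fin (n + 1))), p⟫ = 0 := by
  constructor
  · rintro ⟨p, hP, hp, hp0⟩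
    exact ⟨hP, p, hC.isClosed.frontier_subset hp, hp0⟩
  · rintro ⟨hP, p, hp, h⟩
    exact ⟨p, hP, (mem_frontier_iff hC).2 ⟨hp, P, hP, h⟩, h⟩

/-- If every polar point were orthogonal to some `x ∈ C`, the bipolar theorem would put `-x` in the
cone, which contains no antipodal pair. So each `x` has a polar point positive near it, and
compactness allows finitely many of these to be summed. -/
theorem exists_inner_pos (hC : IsSphericalConvexBody C) :
    ∃ P : UnitSphere n, ∀ x ∈ C, 0 < ⟪(P : EuclideanSpace ℝ (Fin (n + 1))), x⟫ := by
  have key : ∃ g : EuclideanSpace ℝ (Fin (n + 1)), (∀ x ∈ C, 0 ≤ ⟪g, x⟫) ∧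
      ∀ x ∈ C, x ∈ C → 0 < ⟪g, (x : EuclideanSpace ℝ (Fin (n + 1)))⟫ := by
    refine hC.isClosed.isCompact.induction_on (p := fun s =>
      ∃ g : EuclideanSpace ℝ (Fin (n + 1)), (∀ x ∈ C, 0 ≤ ⟪g, x⟫) ∧
        ∀ x ∈ s, x ∈ C → 0 < ⟪g, (x : EuclideanSpace ℝ (Fin (n + 1)))⟫) ?_ ?_ ?_ ?_
    · exact ⟨0, by simp, by simp⟩
    · rintro s t hst ⟨g, hg, hgt⟩
      exact ⟨g, hg, fun x hx => hgt x (hst hx)⟩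
    · rintro s t ⟨g, hg, hgs⟩ ⟨h, hh, hht⟩
      refine ⟨g + h, fun x hx => ?_, ?_⟩
      · rw [inner_add_left]; exact add_nonneg (hg x hx) (hh x hx)
      · rintro x (hx | hx) hxC <;> rw [inner_add_left]
        · exact add_pos_of_pos_of_nonneg (hgs x hx hxC) (hh x hxC)
        · exact add_pos_of_nonneg_of_pos (hg x hxC) (hht x hx hxC)
    · intro x hx
      have hnx : -(x : EuclideanSpace ℝ (Fin (n + 1))) ∉ openCone C := fun h =>
        zero_notMem_openCone (by simpa using add_mem_openCone hC.convex (coe_mem_openCone.2 hx) h)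
      obtain ⟨Q, hQ, hQx⟩ : ∃ Q ∈ dual C, 0 < ⟪(Q : EuclideanSpace ℝ (Fin (n + 1))), x⟫ := by
        by_contra! h
        refine hnx (mem_openCone_of_forall_dual hC.isClosed hC.convex
          (neg_ne_zero.2 (coe_ne_zero x)) fun Q hQ => ?_)
        rw [inner_neg_right]
        linarith [h Q hQ]
      refine ⟨{z | 0 < ⟪(Q : EuclideanSpace ℝ (Fin (n + 1))), (z : EuclideanSpace ℝ (Fin (n + 1)))⟫},
        mem_nhdsWithin_of_mem_nhds ?_, Q, mem_dual.1 hQ, fun z hz _ => hz⟩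
      exact (isOpen_lt continuous_const
        (continuous_const.inner continuous_subtype_val)).mem_nhds hQx
  obtain ⟨g, -, hpos⟩ := key
  obtain ⟨x₀, hx₀⟩ := hC.interior_nonempty
  have hg0 : g ≠ 0 := by
    rintro rfl
    simpa using hpos x₀ (interior_subset hx₀) (interior_subset hx₀)
  obtain ⟨u, hu⟩ := exists_eq_smul_coe hg0
  refine ⟨u, fun x hx => ?_⟩
  have h1 := hpos x hx hx
  rw [hu, inner_smul_left, RCLike.conj_to_real] at h1
  exact pos_of_mul_pos_right h1 (norm_nonneg g)

theorem isSphericalConvexBody_dual (hC : IsSphericalConvexBody C) :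
    IsSphericalConvexBody (dual C) where
  isClosed := isClosed_dual
  convex := by
    obtain ⟨x₀, hx₀⟩ := hC.interior_nonempty
    unfold IsSphericallyConvex
    rw [convex_iff_forall_pos]
    rintro _ ⟨c, hc, u, hu, rfl⟩ _ ⟨d, hd, v, hv, rfl⟩ a b ha hb -
    have hin : ∀ x : UnitSphere n, ⟪a • c • (u : EuclideanSpace ℝ (Fin (n + 1))) +
        b • d • (v : EuclideanSpace ℝ (Fin (n + 1))), x⟫ =
        a * c * ⟪(u : EuclideanSpace ℝ (Fin (n + 1))), x⟫ +
        b * d * ⟪(v : EuclideanSpace ℝ (Fin (n + 1))), x⟫ := by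
      intro x
      simp only [inner_add_left, inner_smul_left, RCLike.conj_to_real]
      ring
    rw [mem_openCone_dual]
    · intro x hx
      rw [hin]
      have h1 : (0 : ℝ) ≤ ⟪(u : EuclideanSpace ℝ (Fin (n + 1))), x⟫ := hu hx
      have h2 : (0 : ℝ) ≤ ⟪(v : EuclideanSpace ℝ (Fin (n + 1))), x⟫ := hv hx
      positivity
    -- The cone omits its apex, so the combination must be nonzero; an interior point of `C` pairs
    -- positively with both terms.
    · intro h
      have h3 := hin x₀
      rw [h, inner_zero_left] at h3
      have h1 := inner_pos_of_mem_interior hx₀ hu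
      have h2 := inner_pos_of_mem_interior hx₀ hv
      have : 0 < a * c * ⟪(u : EuclideanSpace ℝ (Fin (n + 1))), x₀⟫ +
        b * d * ⟪(v : EuclideanSpace ℝ (Fin (n + 1))), x₀⟫ := by positivity
      linarith
  interior_nonempty := by
    obtain ⟨P, hP⟩ := exists_inner_pos hC
    exact ⟨P, mem_interior_dual hC.isClosed hP⟩

/-- First variation of the distance from a point at a farthest point of a convex set. -/
theorem inner_sub_smul_nonneg (hC : IsSphericallyConvex C) {p q : UnitSphere n} (hq : q ∈ C)
    (hmin : ∀ x ∈ C, ⟪(p : EuclideanSpace ℝ (Fin (n + 1))), q⟫ ≤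
      ⟪(p : EuclideanSpace ℝ (Fin (n + 1))), x⟫) {x : UnitSphere n} (hx : x ∈ C) :
    0 ≤ ⟪(p : EuclideanSpace ℝ (Fin (n + 1))) -
      ⟪(p : EuclideanSpace ℝ (Fin (n + 1))), q⟫ • (q : EuclideanSpace ℝ (Fin (n + 1))), x⟫ := by
  rw [inner_sub_left, inner_smul_left, RCLike.conj_to_real]
  set c := ⟪(p : EuclideanSpace ℝ (Fin (n + 1))), q⟫ with hc
  set b := ⟪(p : EuclideanSpace ℝ (Fin (n + 1))), x⟫ with hb
  set a := ⟪(q : EuclideanSpace ℝ (Fin (n + 1))), x⟫ with ha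
  have hc1 : -1 ≤ c := neg_one_le_inner_coe p q
  -- Compare `q` with the normalization `r` of `q + t • x`. Its norm `k` lies between `1 + t * a`
  -- and `1 + t * a + t ^ 2 / 2`; the sign of `c` decides which bound is needed.
  have key : ∀ t : ℝ, 0 < t → -t ≤ b - c * a := by
    intro t ht
    obtain ⟨k, hk, r, hr, hkr⟩ := add_mem_openCone hC (coe_mem_openCone.2 hq)
      (smul_mem_openCone ht (coe_mem_openCone.2 hx))
    have h1 : c + t * b = k * ⟪(p : EuclideanSpace ℝ (Fin (n + 1))), r⟫ := by
      rw [← inner_smul_right (𝕜 := ℝ) _ _ k, ← hkr, inner_add_right, inner_smul_right]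
    have h2 : k ^ 2 = 1 + 2 * t * a + t ^ 2 := by
      have : k ^ 2 = ⟪k • (r : EuclideanSpace ℝ (Fin (n + 1))), k • (r : EuclideanSpace ℝ (Fin (n + 1)))⟫ := by
        rw [inner_smul_left, inner_smul_right, inner_self_coe]; simp; ring
      rw [this, ← hkr]
      simp only [inner_add_left, inner_add_right, inner_smul_left, inner_smul_right,
        RCLike.conj_to_real, inner_self_coe, real_inner_comm (q : EuclideanSpace ℝ (Fin (n + 1))) x]
      rw [← ha]; ring
    have h3 : 1 + t * a ≤ k := by
      have : 1 + t * a = k * ⟪(q : EuclideanSpace ℝ (Fin (n + 1))), r⟫ := by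
        rw [← inner_smul_right (𝕜 := ℝ) _ _ k, ← hkr, inner_add_right, inner_smul_right, inner_self_coe]
      rw [this]
      have := inner_coe_le_one q r
      nlinarith
    have h4 : k ≤ 1 + t * a + t ^ 2 / 2 := by nlinarith [sq_nonneg (k - 1)]
    have h5 : k * c ≤ c + t * b := by rw [h1]; exact mul_le_mul_of_nonneg_left (hmin r hr) hk.le
    have h6 : t * (-t) ≤ t * (b - c * a) := by
      rcases le_total 0 c with h | h
      · nlinarith [mul_le_mul_of_nonneg_right h3 h]
      · nlinarith [mul_le_mul_of_nonpos_right h4 h]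
    exact le_of_mul_le_mul_left h6 ht
  by_contra! hneg
  have := key (-(b - c * a) / 2) (by linarith)
  linarith

theorem dual_nonempty (hC : IsSphericalConvexBody C) : (dual C).Nonempty :=
  (isSphericalConvexBody_dual hC).interior_nonempty.mono interior_subset

/-- Moving a vector along an interior direction of a cone until it lies on the boundary. -/
theorem exists_add_smul_on_boundary (hC : IsSphericalConvexBody C) {x₀ : UnitSphere n}
    (hx₀ : x₀ ∈ interior C) (y : EuclideanSpace ℝ (Fin (n + 1))) :
    ∃ s : ℝ, ∃ Q₀ ∈ dual C,
      (∀ Q ∈ dual C, 0 ≤ ⟪(Q : EuclideanSpace ℝ (Fin (n + 1))), y + s • (x₀ : EuclideanSpace ℝ (Fin (n + 1)))⟫) ∧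
      ⟪(Q₀ : EuclideanSpace ℝ (Fin (n + 1))), y + s • (x₀ : EuclideanSpace ℝ (Fin (n + 1)))⟫ = 0 := by
  have hpos := fun Q (hQ : Q ∈ dual C) => inner_pos_of_mem_interior hx₀ hQ
  -- Each `Q` requires `s` to be at least this quotient; the largest quotient is the least
  -- admissible `s`, and its maximizer gives equality.
  obtain ⟨Q₀, hQ₀, hmax⟩ := (isClosed_dual (C := C)).isCompact.exists_isMaxOn (dual_nonempty hC)
    (f := fun Q => -⟪(Q : EuclideanSpace ℝ (Fin (n + 1))), y⟫ /
      ⟪(Q : EuclideanSpace ℝ (Fin (n + 1))), x₀⟫)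
    (ContinuousOn.div (Continuous.continuousOn (by fun_prop))
      (Continuous.continuousOn (by fun_prop)) fun Q hQ => (hpos Q hQ).ne')
  refine ⟨-⟪(Q₀ : EuclideanSpace ℝ (Fin (n + 1))), y⟫ /
      ⟪(Q₀ : EuclideanSpace ℝ (Fin (n + 1))), x₀⟫, Q₀, hQ₀, fun Q hQ => ?_, ?_⟩
  rotate_left
  · rw [inner_add_right, inner_smul_right, div_mul_cancel₀ _ (hpos Q₀ hQ₀).ne']; ring
  · rw [inner_add_right, inner_smul_right]
    have h : -⟪(Q : EuclideanSpace ℝ (Fin (n + 1))), y⟫ / ⟪(Q : EuclideanSpace ℝ (Fin (n + 1))), x₀⟫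
      ≤ _ := hmax hQ
    rw [div_le_iff₀ (hpos Q hQ)] at h
    linarith

end Duality

/-! ### Normals of bodies of constant diameter -/

section ConstantDiameter

variable {n : ℕ} {C : Set (UnitSphere n)}

theorem abs_inner_coe_le (u : UnitSphere n) (v : EuclideanSpace ℝ (Fin (n + 1))) :
    |⟪(u : EuclideanSpace ℝ (Fin (n + 1))), v⟫| ≤ ‖v‖ := by
  simpa using abs_real_inner_le_norm (u : EuclideanSpace ℝ (Fin (n + 1))) v

/-- A closed family of normals that meets the normal cone at every boundary point contains, at
each boundary point, enough normals to generate the normal cone; this is expressed dually, by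
testing with a vector `v`. -/
theorem exists_normal_inner_le (hC : IsSphericalConvexBody C)
    {R : UnitSphere n → UnitSphere n → Prop}
    (hRclosed : IsClosed {z : UnitSphere n × UnitSphere n | R z.1 z.2})
    (hRdual : ∀ p u, R p u → u ∈ dual C)
    (hRorth : ∀ p u, R p u → ⟪(u : EuclideanSpace ℝ (Fin (n + 1))), p⟫ = 0)
    (hRex : ∀ p ∈ frontier C, ∃ u, R p u)
    {x₀ : UnitSphere n} (hx₀ : x₀ ∈ interior C) {p P : UnitSphere n} (hp : p ∈ C)
    (hP : P ∈ dual C) (hpP : ⟪(P : EuclideanSpace ℝ (Fin (n + 1))), p⟫ = 0)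
    (v : EuclideanSpace ℝ (Fin (n + 1))) :
    ∃ u, R p u ∧ ⟪(u : EuclideanSpace ℝ (Fin (n + 1))), v⟫ *
        ⟪(P : EuclideanSpace ℝ (Fin (n + 1))), x₀⟫ ≤
      ⟪(P : EuclideanSpace ℝ (Fin (n + 1))), v⟫ *
        ⟪(u : EuclideanSpace ℝ (Fin (n + 1))), x₀⟫ := by
  have hpos := fun Q (hQ : Q ∈ dual C) => inner_pos_of_mem_interior hx₀ hQ
  obtain ⟨Qm, hQm, hmin⟩ := (isClosed_dual (C := C)).isCompact.exists_isMinOn (dual_nonempty hC)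
    (f := fun Q => ⟪(Q : EuclideanSpace ℝ (Fin (n + 1))), x₀⟫)
    (Continuous.continuousOn (by fun_prop))
  set m := ⟪(Qm : EuclideanSpace ℝ (Fin (n + 1))), x₀⟫ with hm
  have hm0 : 0 < m := hpos Qm hQm
  have hmle : ∀ Q ∈ dual C, m ≤ ⟪(Q : EuclideanSpace ℝ (Fin (n + 1))), x₀⟫ := fun Q hQ => hmin hQ
  -- Approach `p` in the direction `v`, correcting along `x₀` so as to stay on the boundary of the
  -- cone.
  choose s Q₀ hQ₀ hy hyQ₀ using fun k : ℕ => exists_add_smul_on_boundary hC hx₀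
    ((p : EuclideanSpace ℝ (Fin (n + 1))) + (1 / ((k : ℝ) + 1)) • v)
  have hε : ∀ k : ℕ, 0 < 1 / ((k : ℝ) + 1) := fun k => Nat.one_div_pos_of_nat
  have hexp : ∀ (k : ℕ) (Q : UnitSphere n), ⟪(Q : EuclideanSpace ℝ (Fin (n + 1))),
      p + (1 / ((k : ℝ) + 1)) • v + s k • (x₀ : EuclideanSpace ℝ (Fin (n + 1)))⟫ =
      ⟪(Q : EuclideanSpace ℝ (Fin (n + 1))), p⟫ +
      (1 / ((k : ℝ) + 1)) * ⟪(Q : EuclideanSpace ℝ (Fin (n + 1))), v⟫ +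
      s k * ⟪(Q : EuclideanSpace ℝ (Fin (n + 1))), x₀⟫ := by
    intro k Q
    simp only [inner_add_right, inner_smul_right]
  -- A positive correction is bounded through the contact normal `Q₀ k`, a negative one through `P`.
  have hs : ∀ k, |s k| ≤ 1 / ((k : ℝ) + 1) * (‖v‖ / m) := by
    intro k
    rw [← mul_div_assoc, le_div_iff₀ hm0]
    have hεk := hε k
    have h1 := hyQ₀ k
    have h2 := hy k P hP
    rw [hexp] at h1 h2
    have h3 : (0 : ℝ) ≤ ⟪(Q₀ k : EuclideanSpace ℝ (Fin (n + 1))), p⟫ := hQ₀ k hp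
    have h4 := abs_le.1 (abs_inner_coe_le (Q₀ k) v)
    have h5 := abs_le.1 (abs_inner_coe_le P v)
    have h6 := hmle _ (hQ₀ k)
    have h7 := hmle _ hP
    rcases le_total 0 (s k) with h | h
    · rw [abs_of_nonneg h]
      nlinarith [mul_le_mul_of_nonneg_left h6 h, mul_le_mul_of_nonneg_left h4.1 hεk.le]
    · rw [abs_of_nonpos h]
      nlinarith [mul_le_mul_of_nonneg_left h7 (neg_nonneg.2 h),
        mul_le_mul_of_nonneg_left h5.2 hεk.le]
  have hε0 : Tendsto (fun k : ℕ => 1 / ((k : ℝ) + 1)) atTop (𝓝 0) :=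
    tendsto_one_div_add_atTop_nhds_zero_nat
  have hs0 : Tendsto s atTop (𝓝 0) := by
    refine squeeze_zero_norm (a := fun k : ℕ => 1 / ((k : ℝ) + 1) * (‖v‖ / m)) hs ?_
    simpa using hε0.mul_const (‖v‖ / m)
  set y : ℕ → EuclideanSpace ℝ (Fin (n + 1)) := fun k =>
    p + (1 / ((k : ℝ) + 1)) • v + s k • (x₀ : EuclideanSpace ℝ (Fin (n + 1))) with hydef
  have hylim : Tendsto y atTop (𝓝 p) := by
    have := ((tendsto_const_nhds (x := (p : EuclideanSpace ℝ (Fin (n + 1))))).add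
      (hε0.smul_const v)).add (hs0.smul_const (x₀ : EuclideanSpace ℝ (Fin (n + 1))))
    simpa [hydef] using this
  have hyne : ∀ᶠ k in atTop, y k ≠ 0 := hylim.eventually_ne (coe_ne_zero p)
  -- When `y k = 0` the values are arbitrary; this happens for only finitely many `k`.
  have hsel : ∀ k, ∃ r u : UnitSphere n, y k ≠ 0 → y k = ‖y k‖ • (r : EuclideanSpace ℝ (Fin (n + 1))) ∧ R r u := by
    intro k
    by_cases h : y k = 0
    · exact ⟨p, p, fun h' => (h' h).elim⟩
    obtain ⟨r, hr⟩ := exists_eq_smul_coe h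
    have hk : 0 < ‖y k‖ := norm_pos_iff.2 h
    have hrC : r ∈ C := by
      have := mem_openCone_of_forall_dual hC.isClosed hC.convex h (hy k)
      rw [hr, smul_coe_mem_openCone hk] at this
      exact this
    have hrf : r ∈ frontier C := by
      refine (mem_frontier_iff hC).2 ⟨hrC, Q₀ k, hQ₀ k, ?_⟩
      have h1 : ⟪(Q₀ k : EuclideanSpace ℝ (Fin (n + 1))), y k⟫ = 0 := hyQ₀ k
      rw [hr, inner_smul_right] at h1
      exact (mul_eq_zero.1 h1).resolve_left hk.ne'
    obtain ⟨u, hu⟩ := hRex r hrf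
    exact ⟨r, u, fun _ => ⟨hr, hu⟩⟩
  choose r u hru using hsel
  have hrlim : Tendsto r atTop (𝓝 p) := by
    rw [tendsto_subtype_rng]
    have h1 : Tendsto (fun k => ‖y k‖⁻¹ • y k) atTop (𝓝 (p : EuclideanSpace ℝ (Fin (n + 1)))) := by
      have := (hylim.norm.inv₀ (norm_ne_zero_iff.2 (coe_ne_zero p))).smul hylim
      simpa using this
    refine h1.congr' ?_
    filter_upwards [hyne] with k hk
    obtain ⟨h2, -⟩ := hru k hk
    conv_lhs => rw [h2]
    rw [norm_smul_coe (norm_pos_iff.2 hk), smul_smul, inv_mul_cancel₀ (norm_ne_zero_iff.2 hk),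
      one_smul]
  obtain ⟨a, -, φ, hφ, ha⟩ := (isCompact_univ (X := UnitSphere n)).tendsto_subseq
    (x := u) fun k => Set.mem_univ _
  refine ⟨a, ?_, ?_⟩
  · refine hRclosed.mem_of_tendsto ((hrlim.comp hφ.tendsto_atTop).prodMk_nhds ha) ?_
    filter_upwards [hφ.tendsto_atTop.eventually hyne] with k hk
    exact (hru _ hk).2
  · have hcoe : Tendsto (fun k => ((u (φ k) : EuclideanSpace ℝ (Fin (n + 1))))) atTop (𝓝 a) :=
      (continuous_subtype_val.tendsto a).comp ha
    refine le_of_tendsto_of_tendsto ((hcoe.inner tendsto_const_nhds).mul tendsto_const_nhds)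
      (tendsto_const_nhds.mul (hcoe.inner tendsto_const_nhds)) ?_
    filter_upwards [hφ.tendsto_atTop.eventually hyne] with k hk
    obtain ⟨h1, h2⟩ := hru _ hk
    have hud := hRdual _ _ h2
    have h3 := hexp (φ k) (u (φ k))
    have h4 : ⟪(u (φ k) : EuclideanSpace ℝ (Fin (n + 1))), y (φ k)⟫ = 0 := by
      rw [h1, inner_smul_right, hRorth _ _ h2, mul_zero]
    have h5 : (0 : ℝ) ≤ ⟪(u (φ k) : EuclideanSpace ℝ (Fin (n + 1))), p⟫ := hud hp
    have h6 := hy (φ k) P hP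
    rw [hexp, hpP] at h6
    have h7 : ⟪(u (φ k) : EuclideanSpace ℝ (Fin (n + 1))), y (φ k)⟫ = _ := h3
    rw [h4] at h7
    have h8 := hpos P hP
    have h9 := hpos _ hud
    have hεk := hε (φ k)
    set e := 1 / ((φ k : ℝ) + 1)
    set A := ⟪(u (φ k) : EuclideanSpace ℝ (Fin (n + 1))), v⟫
    set B := ⟪(P : EuclideanSpace ℝ (Fin (n + 1))), v⟫
    set X := ⟪(u (φ k) : EuclideanSpace ℝ (Fin (n + 1))), x₀⟫
    set Y := ⟪(P : EuclideanSpace ℝ (Fin (n + 1))), x₀⟫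
    -- The normal `u (φ k)` vanishes on `y (φ k)` while `P` is nonnegative there; eliminating `s (φ
    -- k)` leaves the inequality, which passes to the limit.
    refine le_of_mul_le_mul_left (?_ : e * (A * Y) ≤ e * (B * X)) hεk
    have h10 : e * A ≤ -(s (φ k) * X) := by linarith
    have h11 : -(s (φ k) * Y) ≤ e * B := by linarith
    nlinarith [mul_le_mul_of_nonneg_right h10 h8.le, mul_le_mul_of_nonneg_right h11 h9.le]

theorem sphDist_eq_iff {P Q : UnitSphere n} {τ : ℝ} (h0 : 0 ≤ τ) (hπ : τ ≤ Real.pi) :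
    sphDist P Q = τ ↔ ⟪(P : EuclideanSpace ℝ (Fin (n + 1))), Q⟫ = Real.cos τ := by
  unfold sphDist
  constructor
  · rintro rfl
    rw [Real.cos_arccos (neg_one_le_inner_coe P Q) (inner_coe_le_one P Q)]
  · intro h
    rw [h, Real.arccos_cos h0 hπ]

theorem sphDist_le_iff {P Q : UnitSphere n} {τ : ℝ} (h0 : 0 ≤ τ) (hπ : τ ≤ Real.pi) :
    sphDist P Q ≤ τ ↔ Real.cos τ ≤ ⟪(P : EuclideanSpace ℝ (Fin (n + 1))), Q⟫ := by
  have hc : Real.cos (sphDist P Q) = ⟪(P : EuclideanSpace ℝ (Fin (n + 1))), Q⟫ :=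
    Real.cos_arccos (neg_one_le_inner_coe P Q) (inner_coe_le_one P Q)
  rw [← hc]
  exact (Real.strictAntiOn_cos.le_iff_ge ⟨h0, hπ⟩
    ⟨Real.arccos_nonneg _, Real.arccos_le_pi _⟩).symm

theorem norm_cos_smul_add_sin_smul (τ : ℝ) {p u : UnitSphere n}
    (h : ⟪(u : EuclideanSpace ℝ (Fin (n + 1))), p⟫ = 0) :
    ‖Real.cos τ • (p : EuclideanSpace ℝ (Fin (n + 1))) + Real.sin τ • (u : EuclideanSpace ℝ (Fin (n + 1)))‖ = 1 := by
  have h' : ⟪(p : EuclideanSpace ℝ (Fin (n + 1))), u⟫ = 0 := by rw [real_inner_comm]; exact h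
  have : ‖Real.cos τ • (p : EuclideanSpace ℝ (Fin (n + 1))) +
      Real.sin τ • (u : EuclideanSpace ℝ (Fin (n + 1)))‖ ^ 2 = 1 := by
    rw [← real_inner_self_eq_norm_sq]
    simp only [inner_add_left, inner_add_right, inner_smul_left, inner_smul_right,
      RCLike.conj_to_real, inner_self_coe, h, h']
    nlinarith [Real.sin_sq_add_cos_sq τ]
  have h0 := norm_nonneg (Real.cos τ • (p : EuclideanSpace ℝ (Fin (n + 1))) +
      Real.sin τ • (u : EuclideanSpace ℝ (Fin (n + 1))))
  nlinarith

/-- `u` is an inner normal of `C` at `p` such that the geodesic of length `τ`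
issuing from `p` in the direction `u` ends in `C`. -/
def IsDiametralNormal (C : Set (UnitSphere n)) (τ : ℝ) (p u : UnitSphere n) : Prop :=
  u ∈ dual C ∧ ⟪(u : EuclideanSpace ℝ (Fin (n + 1))), p⟫ = 0 ∧
    ∃ q ∈ C, (q : EuclideanSpace ℝ (Fin (n + 1))) =
      Real.cos τ • (p : EuclideanSpace ℝ (Fin (n + 1))) +
        Real.sin τ • (u : EuclideanSpace ℝ (Fin (n + 1)))

theorem isClosed_isDiametralNormal (hC : IsClosed C) (τ : ℝ) :
    IsClosed {z : UnitSphere n × UnitSphere n | IsDiametralNormal C τ z.1 z.2} := by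
  have himg : IsClosed ((↑) '' C : Set (EuclideanSpace ℝ (Fin (n + 1)))) :=
    (hC.isCompact.image continuous_subtype_val).isClosed
  have h1 : IsClosed {z : UnitSphere n × UnitSphere n | z.2 ∈ dual C} :=
    isClosed_dual.preimage continuous_snd
  have hf : Continuous fun z : UnitSphere n × UnitSphere n =>
      (z.1 : EuclideanSpace ℝ (Fin (n + 1))) := continuous_subtype_val.comp continuous_fst
  have hg : Continuous fun z : UnitSphere n × UnitSphere n =>
      (z.2 : EuclideanSpace ℝ (Fin (n + 1))) := continuous_subtype_val.comp continuous_snd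
  have h2 : IsClosed {z : UnitSphere n × UnitSphere n |
      ⟪(z.2 : EuclideanSpace ℝ (Fin (n + 1))), (z.1 : EuclideanSpace ℝ (Fin (n + 1)))⟫ = 0} :=
    isClosed_eq (hg.inner hf) continuous_const
  have h3 := himg.preimage ((hf.const_smul (Real.cos τ)).add (hg.const_smul (Real.sin τ)))
  exact h1.inter (h2.inter h3)

variable {τ : ℝ}

/-- If `p` is a point of `C` at maximal distance `τ` from `q`, then the initial direction of the
geodesic from `p` to `q` is a normal of `C` at `p`. -/
theorem exists_normal_of_farthest (hC : IsSphericallyConvex C) (hτ0 : 0 < τ) (hτπ : τ < Real.pi)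
    {p q : UnitSphere n} (hp : p ∈ C)
    (hmin : ∀ x ∈ C, Real.cos τ ≤ ⟪(q : EuclideanSpace ℝ (Fin (n + 1))), x⟫)
    (hqp : ⟪(q : EuclideanSpace ℝ (Fin (n + 1))), p⟫ = Real.cos τ) :
    ∃ u ∈ dual C, ⟪(u : EuclideanSpace ℝ (Fin (n + 1))), p⟫ = 0 ∧
      (q : EuclideanSpace ℝ (Fin (n + 1))) =
      Real.cos τ • (p : EuclideanSpace ℝ (Fin (n + 1))) +
        Real.sin τ • (u : EuclideanSpace ℝ (Fin (n + 1))) := by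
  have hsin : 0 < Real.sin τ := Real.sin_pos_of_pos_of_lt_pi hτ0 hτπ
  have hpq : ⟪(p : EuclideanSpace ℝ (Fin (n + 1))), q⟫ = Real.cos τ := by
    rw [real_inner_comm]; exact hqp
  have hvar := fun x hx => inner_sub_smul_nonneg hC (p := q) hp
    (fun x hx => hqp ▸ hmin x hx) (x := x) hx
  rw [hqp] at hvar
  set w := (q : EuclideanSpace ℝ (Fin (n + 1))) - Real.cos τ • (p : EuclideanSpace ℝ (Fin (n + 1)))
    with hw
  have hwn : ‖w‖ = Real.sin τ := by
    have h2 : ‖w‖ ^ 2 = Real.sin τ ^ 2 := by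
      rw [← real_inner_self_eq_norm_sq, hw]
      simp only [inner_sub_left, inner_sub_right, inner_smul_left, inner_smul_right,
        RCLike.conj_to_real, inner_self_coe, hpq, hqp]
      nlinarith [Real.sin_sq_add_cos_sq τ]
    exact (pow_left_inj₀ (norm_nonneg _) hsin.le two_ne_zero).1 h2
  have hw0 : w ≠ 0 := norm_ne_zero_iff.1 (hwn ▸ hsin.ne')
  obtain ⟨u, hu⟩ := exists_eq_smul_coe hw0
  have hq' : (q : EuclideanSpace ℝ (Fin (n + 1))) =
      Real.cos τ • (p : EuclideanSpace ℝ (Fin (n + 1))) +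
        Real.sin τ • (u : EuclideanSpace ℝ (Fin (n + 1))) := by
    rw [← hwn, ← hu, hw]; abel
  refine ⟨u, ?_, ?_, hq'⟩
  · have := (mem_openCone_dual hw0).2 hvar
    rw [hu, smul_coe_mem_openCone (norm_pos_iff.2 hw0)] at this
    exact this
  · have h1 : ⟪w, (p : EuclideanSpace ℝ (Fin (n + 1)))⟫ = 0 := by
      rw [hw, inner_sub_left, inner_smul_left, inner_self_coe, hqp]; simp
    rw [hu, inner_smul_left, RCLike.conj_to_real, hwn] at h1
    exact (mul_eq_zero.1 h1).resolve_left hsin.ne'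

/-- Completeness of bodies of constant diameter at most `π / 2`. -/
theorem mem_of_forall_cos_le_inner (hC : IsSphericalConvexBody C) (hτ0 : 0 < τ)
    (hτ2 : τ ≤ Real.pi / 2)
    (hfront : ∀ p ∈ frontier C, ∃ u, IsDiametralNormal C τ p u) {z : UnitSphere n}
    (hz : ∀ w ∈ C, Real.cos τ ≤ ⟪(w : EuclideanSpace ℝ (Fin (n + 1))), z⟫) : z ∈ C := by
  have hcos : 0 ≤ Real.cos τ := Real.cos_nonneg_of_neg_pi_div_two_le_of_le (by linarith) hτ2
  have hsin : 0 < Real.sin τ := Real.sin_pos_of_pos_of_lt_pi hτ0 (by linarith [Real.pi_pos])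
  obtain ⟨x₀, hx₀⟩ := hC.interior_nonempty
  obtain ⟨s, Q₀, hQ₀, hs, hsQ₀⟩ := exists_add_smul_on_boundary hC hx₀
    (z : EuclideanSpace ℝ (Fin (n + 1)))
  rcases le_or_gt s 0 with hs0 | hs0
  · refine coe_mem_openCone.1 (mem_openCone_of_forall_dual hC.isClosed hC.convex
      (coe_ne_zero z) fun Q hQ => ?_)
    have h1 := hs Q hQ
    have h2 := inner_pos_of_mem_interior hx₀ hQ
    rw [inner_add_right, inner_smul_right] at h1
    nlinarith
  -- For `s > 0`, the segment from `z` to `x₀` crosses the boundary ray of `p`. A diametral normal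
  -- `u` at `p` is negative at `z`, so the other end `q` of its geodesic is farther than `τ` from
  -- `z`.
  exfalso
  set y := (z : EuclideanSpace ℝ (Fin (n + 1))) + s • (x₀ : EuclideanSpace ℝ (Fin (n + 1))) with hy
  have hy0 : y ≠ 0 := by
    intro h
    have h1 : ⟪(x₀ : EuclideanSpace ℝ (Fin (n + 1))), y⟫ = 0 := by rw [h, inner_zero_right]
    rw [hy, inner_add_right, inner_smul_right, inner_self_coe] at h1
    linarith [hz x₀ (interior_subset hx₀)]
  have hyn : 0 < ‖y‖ := norm_pos_iff.2 hy0
  have hyC := mem_openCone_of_forall_dual hC.isClosed hC.convex hy0 hs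
  obtain ⟨p, hp⟩ := exists_eq_smul_coe hy0
  rw [hp, smul_coe_mem_openCone hyn] at hyC
  have hpf : p ∈ frontier C := by
    refine (mem_frontier_iff hC).2 ⟨hyC, Q₀, hQ₀, ?_⟩
    rw [hp, inner_smul_right] at hsQ₀
    exact (mul_eq_zero.1 hsQ₀).resolve_left hyn.ne'
  obtain ⟨u, hu, hup, q, hq, hqe⟩ := hfront p hpf
  have h1 : ⟪(u : EuclideanSpace ℝ (Fin (n + 1))), y⟫ = 0 := by
    rw [hp, inner_smul_right, hup, mul_zero]
  rw [hy, inner_add_right, inner_smul_right] at h1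
  have h2 := mul_pos hs0 (inner_pos_of_mem_interior hx₀ hu)
  have h3 := hz q hq
  rw [hqe, inner_add_left, inner_smul_left, inner_smul_left, RCLike.conj_to_real,
    RCLike.conj_to_real] at h3
  have h4 := inner_coe_le_one p z
  nlinarith

/-- In a body of constant diameter `τ`, every normal is diametral. -/
theorem isDiametralNormal_of_inner_eq_zero (hC : IsSphericalConvexBody C) (hτ0 : 0 < τ)
    (hτπ : τ < Real.pi)
    (hdiam : ∀ p ∈ C, ∀ q ∈ C, Real.cos τ ≤ ⟪(p : EuclideanSpace ℝ (Fin (n + 1))), q⟫)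
    (hfront : ∀ p ∈ frontier C, ∃ q ∈ C,
      ⟪(p : EuclideanSpace ℝ (Fin (n + 1))), q⟫ = Real.cos τ)
    {p P : UnitSphere n} (hp : p ∈ C) (hP : P ∈ dual C)
    (hpP : ⟪(P : EuclideanSpace ℝ (Fin (n + 1))), p⟫ = 0) : IsDiametralNormal C τ p P := by
  have hsin : 0 < Real.sin τ := Real.sin_pos_of_pos_of_lt_pi hτ0 hτπ
  have hR : ∀ p ∈ frontier C, ∃ u, IsDiametralNormal C τ p u := fun r hr => by
    obtain ⟨q, hq, hrq⟩ := hfront r hr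
    obtain ⟨u, hu, hur, hqe⟩ := exists_normal_of_farthest hC.convex hτ0 hτπ
      (hC.isClosed.frontier_subset hr) (hdiam q hq) (by rw [real_inner_comm]; exact hrq)
    exact ⟨u, hu, hur, q, hq, hqe⟩
  obtain ⟨x₀, hx₀⟩ := hC.interior_nonempty
  have key := exists_normal_inner_le hC (isClosed_isDiametralNormal hC.isClosed τ)
    (fun _ _ h => h.1) (fun _ _ h => h.2.1) hR hx₀ hp hP hpP
  have hPx := inner_pos_of_mem_interior hx₀ hP
  rcases le_or_gt τ (Real.pi / 2) with hτ2 | hτ2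
  · refine ⟨hP, hpP, ?_⟩
    have hcos : 0 ≤ Real.cos τ := Real.cos_nonneg_of_neg_pi_div_two_le_of_le (by linarith) hτ2
    have hn := norm_cos_smul_add_sin_smul τ hpP
    obtain ⟨z, hz⟩ : ∃ z : UnitSphere n, (z : EuclideanSpace ℝ (Fin (n + 1))) =
        Real.cos τ • (p : EuclideanSpace ℝ (Fin (n + 1))) +
        Real.sin τ • (P : EuclideanSpace ℝ (Fin (n + 1))) := ⟨⟨_, by simpa using hn⟩, rfl⟩
    refine ⟨z, mem_of_forall_cos_le_inner hC hτ0 hτ2 hR fun w hw => ?_, hz⟩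
    -- For a normal `u` at `p`, the bound `⟪u, w⟫ ≥ a` says exactly that `cos τ • p + sin τ • u` is
    -- within `τ` of `w`. Diametral normals satisfy it; testing with `w - a • P` transfers it to
    -- `P`, using `0 ≤ a` and `⟪u, P⟫ ≤ 1`.
    set a := Real.cos τ * (1 - ⟪(p : EuclideanSpace ℝ (Fin (n + 1))), w⟫) / Real.sin τ with ha
    have has : a * Real.sin τ = Real.cos τ * (1 - ⟪(p : EuclideanSpace ℝ (Fin (n + 1))), w⟫) :=
      div_mul_cancel₀ _ hsin.ne'
    have ha0 : 0 ≤ a :=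
      div_nonneg (mul_nonneg hcos (sub_nonneg.2 (inner_coe_le_one p w))) hsin.le
    obtain ⟨u, ⟨hu, hup, q, hq, hqe⟩, hle⟩ := key
      ((w : EuclideanSpace ℝ (Fin (n + 1))) - a • (P : EuclideanSpace ℝ (Fin (n + 1))))
    simp only [inner_sub_right, inner_smul_right, inner_self_coe, mul_one] at hle
    have h1 := hdiam q hq w hw
    rw [hqe, inner_add_left, inner_smul_left, inner_smul_left, RCLike.conj_to_real,
      RCLike.conj_to_real] at h1
    have h2 : a ≤ ⟪(u : EuclideanSpace ℝ (Fin (n + 1))), w⟫ := by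
      refine le_of_mul_le_mul_right ?_ hsin
      rw [has]; linarith
    have h3 := mul_le_mul_of_nonneg_left (inner_coe_le_one u P) ha0
    have h4 : 0 ≤ ⟪(P : EuclideanSpace ℝ (Fin (n + 1))), w⟫ - a := by
      refine nonneg_of_mul_nonneg_left (le_trans (mul_nonneg ?_ hPx.le) hle)
        (inner_pos_of_mem_interior hx₀ hu)
      linarith
    rw [real_inner_comm, hz, inner_add_left, inner_smul_left, inner_smul_left,
      RCLike.conj_to_real, RCLike.conj_to_real]
    nlinarith
  · have hcos : Real.cos τ < 0 := Real.cos_neg_of_pi_div_two_lt_of_lt hτ2 (by linarith)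
    have hpf : p ∈ frontier C := (mem_frontier_iff hC).2 ⟨hp, P, hP, hpP⟩
    obtain ⟨u₀, hu₀⟩ := hR p hpf
    have huniq : ∀ u, IsDiametralNormal C τ p u → u = u₀ := by
      rintro u ⟨-, hup, q, hq, hqe⟩
      obtain ⟨-, hup₀, q₀, hq₀, hqe₀⟩ := hu₀
      rw [real_inner_comm] at hup hup₀
      have h1 : ⟪(p : EuclideanSpace ℝ (Fin (n + 1))), q⟫ = Real.cos τ := by
        rw [hqe, inner_add_right, inner_smul_right, inner_smul_right, inner_self_coe, hup]; ring
      have h1₀ : ⟪(p : EuclideanSpace ℝ (Fin (n + 1))), q₀⟫ = Real.cos τ := by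
        rw [hqe₀, inner_add_right, inner_smul_right, inner_smul_right, inner_self_coe, hup₀]; ring
      obtain ⟨c, hc, x, hx, hxe⟩ := add_mem_openCone hC.convex (coe_mem_openCone.2 hq)
        (coe_mem_openCone.2 hq₀)
      have h2 : 2 * Real.cos τ = c * ⟪(p : EuclideanSpace ℝ (Fin (n + 1))), x⟫ := by
        rw [← inner_smul_right (𝕜 := ℝ) _ _ c, ← hxe, inner_add_right, h1, h1₀]; ring
      -- As `cos τ < 0`, a sum `q + q₀` of norm below 2 would put its normalization `x` farther than
      -- `τ` from `p`; hence the norm is 2 and `q = q₀`.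
      have h3 : 2 ≤ c := by nlinarith [mul_le_mul_of_nonneg_left (hdiam p hp x hx) hc.le]
      have h4 : c = ⟪(q : EuclideanSpace ℝ (Fin (n + 1))), x⟫ +
          ⟪(q₀ : EuclideanSpace ℝ (Fin (n + 1))), x⟫ := by
        rw [← inner_add_left, hxe, inner_smul_left, inner_self_coe]; simp
      have h5 := inner_coe_le_one q x
      have h6 := inner_coe_le_one q₀ x
      have h7 : q = q₀ := by
        rw [eq_of_one_le_inner (u := q) (v := x) (by linarith),
          eq_of_one_le_inner (u := q₀) (v := x) (by linarith)]
      have h8 : Real.sin τ • (u : EuclideanSpace ℝ (Fin (n + 1))) =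
          Real.sin τ • (u₀ : EuclideanSpace ℝ (Fin (n + 1))) := by
        rw [h7, hqe₀] at hqe
        exact (add_left_cancel hqe).symm
      exact Subtype.ext (smul_right_injective _ hsin.ne' h8)
    -- Here `u = u₀`, so the two sides of `hle` have opposite signs unless `⟪u₀, P⟫ = 1`.
    obtain ⟨u, hu, hle⟩ := key
      ((u₀ : EuclideanSpace ℝ (Fin (n + 1))) - (P : EuclideanSpace ℝ (Fin (n + 1))))
    rw [huniq u hu] at hle
    have hux := inner_pos_of_mem_interior hx₀ hu₀.1
    simp only [inner_sub_right, inner_self_coe,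
      real_inner_comm (u₀ : EuclideanSpace ℝ (Fin (n + 1))) P] at hle
    have : u₀ = P := eq_of_one_le_inner (by nlinarith)
    exact this ▸ hu₀

end ConstantDiameter

/-! ### Passage between diameter and width -/

section ConstantWidth

variable {n : ℕ} {C : Set (UnitSphere n)} {τ : ℝ}

theorem HasConstantDiameter.hasConstantWidth (hC : IsSphericalConvexBody C) (hτ0 : 0 < τ)
    (hτπ : τ < Real.pi) (h : HasConstantDiameter C τ) : HasConstantWidth C τ := by
  have hsin : 0 < Real.sin τ := Real.sin_pos_of_pos_of_lt_pi hτ0 hτπ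
  have hcos1 : -1 < Real.cos τ := by
    rw [← Real.cos_pi]
    exact Real.cos_lt_cos_of_nonneg_of_le_pi hτ0.le le_rfl hτπ
  have hcos2 : Real.cos τ < 1 := by
    rw [← Real.cos_zero]
    exact Real.cos_lt_cos_of_nonneg_of_le_pi le_rfl hτπ.le hτ0
  have hdiam : ∀ p ∈ C, ∀ q ∈ C, Real.cos τ ≤ ⟪(p : EuclideanSpace ℝ (Fin (n + 1))), q⟫ :=
    fun p hp q hq => (sphDist_le_iff hτ0.le hτπ.le).1 (h.1.2 ⟨p, hp, q, hq, rfl⟩)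
  have hfront : ∀ p ∈ frontier C, ∃ q ∈ C,
      ⟪(p : EuclideanSpace ℝ (Fin (n + 1))), q⟫ = Real.cos τ := fun p hp => by
    obtain ⟨q, hq, hpq⟩ := h.2 p hp
    exact ⟨q, hq, (sphDist_eq_iff hτ0.le hτπ.le).1 hpq⟩
  intro P hPs
  obtain ⟨hP, p, hp, hPp⟩ := (isSupportingHemisphere_iff hC).1 hPs
  have hpP : ⟪(p : EuclideanSpace ℝ (Fin (n + 1))), P⟫ = 0 := by rw [real_inner_comm]; exact hPp
  obtain ⟨-, -, q, hq, hqe⟩ := isDiametralNormal_of_inner_eq_zero hC hτ0 hτπ hdiam hfront hp hP hPp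
  have hpq : ⟪(p : EuclideanSpace ℝ (Fin (n + 1))), q⟫ = Real.cos τ := by
    rw [hqe, inner_add_right, inner_smul_right, inner_smul_right, inner_self_coe, hpP]; ring
  -- The normal at the far end `q` of the diametral geodesic from `p` closes a lune of thickness
  -- `τ`.
  obtain ⟨Q, hQ, hQq, hpe⟩ := exists_normal_of_farthest hC.convex hτ0 hτπ hq (hdiam p hp) hpq
  have hPQ : ⟪(P : EuclideanSpace ℝ (Fin (n + 1))), Q⟫ = -Real.cos τ := by
    have h1 : ⟪(P : EuclideanSpace ℝ (Fin (n + 1))), q⟫ = Real.sin τ := by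
      rw [hqe, inner_add_right, inner_smul_right, inner_smul_right, inner_self_coe, hPp]; ring
    have h2 := hPp
    rw [hpe, inner_add_right, inner_smul_right, inner_smul_right, h1] at h2
    have h3 : Real.sin τ * (Real.cos τ + ⟪(P : EuclideanSpace ℝ (Fin (n + 1))), Q⟫) = 0 := by
      linarith
    linarith [(mul_eq_zero.1 h3).resolve_left hsin.ne']
  refine ⟨⟨Q, ⟨?_, ?_⟩, hQ, ?_⟩, ?_⟩
  · rintro rfl
    rw [inner_self_coe] at hPQ
    linarith
  · rintro rfl
    rw [coe_neg_sphere, inner_neg_right, inner_self_coe] at hPQ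
    linarith
  · rw [luneThickness, (sphDist_eq_iff (τ := Real.pi - τ) (by linarith) (by linarith)).2
      (by rw [Real.cos_pi_sub]; exact hPQ)]
    ring
  · rintro _ ⟨Q', -, hQ', rfl⟩
    -- Take `Q₁` in the polar farthest from `P`, at distance `δ`. By biduality it supports `C` at
    -- some `r` on the great circle through `P` and `Q₁`; the diametral point `t` from `r` satisfies
    -- `⟪P, t⟫ = sin (δ + τ)`, and `t ∈ C` forces `δ + τ ≤ π`.
    obtain ⟨Q₁, hQ₁, hmin⟩ := (isClosed_dual (C := C)).isCompact.exists_isMinOn (dual_nonempty hC)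
      (f := fun Q => ⟪(P : EuclideanSpace ℝ (Fin (n + 1))), Q⟫)
      (Continuous.continuousOn (by fun_prop))
    have hδcos : Real.cos (sphDist P Q₁) = ⟪(P : EuclideanSpace ℝ (Fin (n + 1))), Q₁⟫ :=
      Real.cos_arccos (neg_one_le_inner_coe P Q₁) (inner_coe_le_one P Q₁)
    have hmin' : ∀ Q ∈ dual C, Real.cos (sphDist P Q₁) ≤
        ⟪(P : EuclideanSpace ℝ (Fin (n + 1))), Q⟫ := fun Q hQ => hδcos ▸ hmin hQ
    obtain ⟨x₀, hx₀⟩ := hC.interior_nonempty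
    have hne : Q₁ ≠ -P := by
      rintro rfl
      have h1 := inner_pos_of_mem_interior hx₀ hQ₁
      have h2 := inner_pos_of_mem_interior hx₀ hP
      rw [coe_neg_sphere, inner_neg_left] at h1
      linarith
    set δ := sphDist P Q₁ with hδ
    have hδ0 : 0 < δ := by
      refine Real.arccos_pos.2 ?_
      rw [← hδcos]
      linarith [hmin' Q hQ, hPQ]
    have hδπ : δ < Real.pi := by
      refine lt_of_le_of_ne (Real.arccos_le_pi _) fun h1 => hne ?_
      refine eq_neg_of_inner_le_neg_one ?_
      rw [← hδcos, h1, Real.cos_pi]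
    obtain ⟨r, hr, hrQ₁, hPe⟩ := exists_normal_of_farthest (isSphericalConvexBody_dual hC).convex
      hδ0 hδπ hQ₁ hmin' hδcos.symm
    rw [dual_dual hC.isClosed hC.convex] at hr
    have hQ₁r : ⟪(Q₁ : EuclideanSpace ℝ (Fin (n + 1))), r⟫ = 0 := by
      rw [real_inner_comm]; exact hrQ₁
    obtain ⟨-, -, t, ht, hte⟩ :=
      isDiametralNormal_of_inner_eq_zero hC hτ0 hτπ hdiam hfront hr hQ₁ hQ₁r
    have h1 : (0 : ℝ) ≤ ⟪(P : EuclideanSpace ℝ (Fin (n + 1))), t⟫ := hP ht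
    have h2 : ⟪(P : EuclideanSpace ℝ (Fin (n + 1))), t⟫ = Real.sin (δ + τ) := by
      rw [hPe, hte, Real.sin_add]
      simp only [inner_add_left, inner_add_right, inner_smul_left, inner_smul_right,
        RCLike.conj_to_real, inner_self_coe, hrQ₁, hQ₁r]
      ring
    have h3 : δ + τ ≤ Real.pi := by
      by_contra! h4
      have h5 := Real.sin_neg_of_neg_of_neg_pi_lt (x := δ + τ - 2 * Real.pi) (by linarith)
        (by linarith)
      rw [Real.sin_sub_two_pi] at h5
      linarith
    have h4 : sphDist P Q' ≤ δ :=
      (sphDist_le_iff hδ0.le hδπ.le).2 (hmin' Q' hQ')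
    rw [luneThickness]
    linarith

/-- If `P` were the only polar point, the cone would contain every nonzero vector orthogonal to `P`,
hence an antipodal pair. This is where `n ≥ 1` enters: on `S^0` the polar of a point is a point. -/
theorem not_subsingleton_dual (hn : 1 ≤ n) (hC : IsSphericalConvexBody C) :
    ¬ (dual C).Subsingleton := by
  intro hsub
  obtain ⟨P, hP⟩ := dual_nonempty hC
  have hfin : Module.finrank ℝ (EuclideanSpace ℝ (Fin (n + 1))) = n + 1 := by simp
  have : Fact (Module.finrank ℝ (EuclideanSpace ℝ (Fin (n + 1))) = n + 1) := ⟨hfin⟩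
  have hrank := Submodule.finrank_orthogonal_span_singleton (𝕜 := ℝ) (n := n) (coe_ne_zero P)
  obtain ⟨v, hv, hv0⟩ := Submodule.exists_mem_ne_zero_of_ne_bot
    (p := (Submodule.span ℝ {(P : EuclideanSpace ℝ (Fin (n + 1)))})ᗮ) (by
      intro h
      rw [h, finrank_bot] at hrank
      omega)
  have hPv := Submodule.mem_orthogonal_singleton_iff_inner_right.1 hv
  have hmem : ∀ w : EuclideanSpace ℝ (Fin (n + 1)), w ≠ 0 →
      ⟪(P : EuclideanSpace ℝ (Fin (n + 1))), w⟫ = 0 → w ∈ openCone C := fun w hw hPw =>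
    mem_openCone_of_forall_dual hC.isClosed hC.convex hw fun Q hQ => by
      rw [hsub hQ hP, hPw]
  have h := add_mem_openCone hC.convex (hmem v hv0 hPv)
    (hmem (-v) (neg_ne_zero.2 hv0) (by rw [inner_neg_right, hPv, neg_zero]))
  rw [add_neg_cancel] at h
  exact zero_notMem_openCone h

theorem HasConstantWidth.hasConstantDiameter_dual (hn : 1 ≤ n) (hC : IsSphericalConvexBody C)
    (h : HasConstantWidth C τ) :
    HasConstantDiameter (dual C) (Real.pi - τ) := by
  have hK := isSphericalConvexBody_dual hC
  have hKK := dual_dual hC.isClosed hC.convex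
  obtain ⟨x₀, hx₀⟩ := hC.interior_nonempty
  have hanti : ∀ P ∈ dual C, ∀ Q ∈ dual C, Q ≠ -P := by
    rintro P hP _ hQ rfl
    have h1 := inner_pos_of_mem_interior hx₀ hQ
    have h2 := inner_pos_of_mem_interior hx₀ hP
    rw [coe_neg_sphere, inner_neg_left] at h1
    linarith
  have hatt : ∀ P ∈ dual C, (∃ p ∈ C, ⟪(P : EuclideanSpace ℝ (Fin (n + 1))), p⟫ = 0) →
      ∃ Q ∈ dual C, sphDist P Q = Real.pi - τ := by
    intro P hP hp
    obtain ⟨Q, -, hQ, hQe⟩ := (h P ((isSupportingHemisphere_iff hC).2 ⟨hP, hp⟩)).1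
    rw [luneThickness] at hQe
    exact ⟨Q, hQ, by linarith⟩
  have hle : ∀ P ∈ dual C, (∃ p ∈ C, ⟪(P : EuclideanSpace ℝ (Fin (n + 1))), p⟫ = 0) →
      ∀ Q ∈ dual C, Q ≠ P → sphDist P Q ≤ Real.pi - τ := by
    intro P hP hp Q hQ hne
    have h1 := (h P ((isSupportingHemisphere_iff hC).2 ⟨hP, hp⟩)).2
      ⟨Q, ⟨hne.symm, hanti P hP Q hQ⟩, hQ, rfl⟩
    rw [luneThickness] at h1
    linarith
  refine ⟨?_, fun P hP => ?_⟩
  -- The width hypothesis concerns only boundary points of the polar. An endpoint `P` of a farthest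
  -- pair is one, since the geodesic to `Q` gives a normal there, so the bound at `P` covers all
  -- pairs.
  · obtain ⟨⟨Q, P⟩, ⟨hQ, hP⟩, hmin⟩ :=
      ((isClosed_dual (C := C)).isCompact.prod (isClosed_dual (C := C)).isCompact).exists_isMinOn
      ((dual_nonempty hC).prod (dual_nonempty hC))
      (f := fun z => ⟪(z.1 : EuclideanSpace ℝ (Fin (n + 1))), z.2⟫)
      (Continuous.continuousOn (by fun_prop))
    have hcos : Real.cos (sphDist Q P) = ⟪(Q : EuclideanSpace ℝ (Fin (n + 1))), P⟫ :=
      Real.cos_arccos (neg_one_le_inner_coe Q P) (inner_coe_le_one Q P)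
    have hmin' : ∀ A ∈ dual C, ∀ B ∈ dual C, Real.cos (sphDist Q P) ≤
        ⟪(A : EuclideanSpace ℝ (Fin (n + 1))), B⟫ := fun A hA B hB =>
      hcos ▸ hmin (Set.mk_mem_prod hA hB)
    have hQP : Q ≠ P := by
      rintro rfl
      refine not_subsingleton_dual hn hC fun A hA B hB => eq_of_one_le_inner ?_
      have h1 := hmin' A hA B hB
      rwa [hcos, inner_self_coe] at h1
    have h0 : 0 < sphDist Q P := by
      refine Real.arccos_pos.2 (lt_of_not_ge fun h1 => hQP (eq_of_one_le_inner h1))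
    have hπ : sphDist Q P < Real.pi := by
      refine lt_of_le_of_ne (Real.arccos_le_pi _) fun h1 => hanti Q hQ P hP ?_
      refine eq_neg_of_inner_le_neg_one ?_
      rw [← hcos, h1, Real.cos_pi]
    obtain ⟨u, hu, huP, -⟩ := exists_normal_of_farthest hK.convex h0 hπ hP (hmin' Q hQ) hcos.symm
    rw [hKK] at hu
    rw [real_inner_comm] at huP
    have hub : ∀ A ∈ dual C, ∀ B ∈ dual C, sphDist A B ≤ Real.pi - τ := by
      intro A hA B hB
      refine ((sphDist_le_iff h0.le hπ.le).2 (hmin' A hA B hB)).trans ?_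
      have h1 := hle P hP ⟨u, hu, huP⟩ Q hQ hQP
      rwa [sphDist, real_inner_comm] at h1
    obtain ⟨Q', hQ', hd⟩ := hatt P hP ⟨u, hu, huP⟩
    refine ⟨⟨P, hP, Q', hQ', hd.symm⟩, ?_⟩
    rintro _ ⟨A, hA, B, hB, rfl⟩
    exact hub A hA B hB
  · obtain ⟨hP', x, hx, hxP⟩ := (mem_frontier_iff hK).1 hP
    rw [hKK] at hx
    exact hatt P hP' ⟨x, hx, by rw [real_inner_comm]; exact hxP⟩

end ConstantWidth

end SphericalConvexity

theorem theorem1p1 (n : ℕ) (hn : 1 ≤ n) (C : Set (SphericalConvexity.UnitSphere n))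
    (hC : SphericalConvexity.IsSphericalConvexBody C) (τ : ℝ) (hτ0 : 0 < τ) (hτπ : τ < Real.pi) :
    SphericalConvexity.HasConstantDiameter C τ ↔ SphericalConvexity.HasConstantWidth C τ := by
  refine ⟨fun h => h.hasConstantWidth hC hτ0 hτπ, fun h => ?_⟩
  have hK := SphericalConvexity.isSphericalConvexBody_dual hC
  have h1 := (h.hasConstantDiameter_dual hn hC).hasConstantWidth hK
    (by linarith) (by linarith)
  have h2 := h1.hasConstantDiameter_dual hn hK
  rwa [SphericalConvexity.dual_dual hC.isClosed hC.convex, sub_sub_cancel] at h2
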